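/- Let $\mathfrak g=\mathfrak g_{\bar 0}\oplus\mathfrak g_{\bar 1}$ be a finite-dimensional complex super vector space with a non-degenerate bilinear form $(\cdot,\cdot)$ which is super-symmetric, $(x,y)=(-1)^{|x||y|}(y,x)$ for homogeneous $x,y$, and consistent, $(\mathfrak g_{\bar 0},\mathfrak g_{\bar 1})=(\mathfrak g_{\bar 1},\mathfrak g_{\bar 0})=0$. Let $C(\mathfrak g)$ (resp. $\Lambda(\mathfrak g)$) be the unital associative algebra generated by the vector space $\mathfrak g$ with the relations $xy+(-1)^{|x||y|}yx=2(x,y)$ (resp. $x\wedge y+(-1)^{|x||y|}y\wedge x=0$) for homogeneous $x,y\in\mathfrak g$. Let $\Lambda^3_{\bar 0}(\mathfrak g)$ be the span of the products $x_1\wedge x_2\wedge x_3$ of homogeneous vectors with $|x_1|+|x_2|+|x_3|=\bar 0$. For $x\in\mathfrak g$ let $\iota(x)$ be the linear operator on $\Lambda(\mathfrak g)$, linear in $x$, with $\iota(x)1=0$ and $\iota(x)(y\wedge u)=(x,y)u-(-1)^{|x||y|}\,y\wedge\iota(x)u$ for homogeneous $x,y\in\mathfrak g$ and $u\in\Lambda(\mathfrak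 g)$. Let $\gamma:C(\mathfrak g)\to\operatorname{End}\Lambda(\mathfrak g)$ be the algebra homomorphism with $\gamma(x)u=x\wedge u+\iota(x)u$ for $x\in\mathfrak g$, and identify $C(\mathfrak g)$ with $\Lambda(\mathfrak g)$ by the linear isomorphism $\eta(a)=\gamma(a)1$. The Clifford square $\varphi^2$ of $\varphi\in\Lambda(\mathfrak g)$ is its square in $C(\mathfrak g)$ under this identification. A quadratic Lie superalgebra structure on $\mathfrak g$ (with respect to $(\cdot,\cdot)$) is a bilinear bracket with $[\mathfrak g_i,\mathfrak g_j]\subset\mathfrak g_{i+j}$ such that $[x,y]=-(-1)^{|x||y|}[y,x]$ and $[x,[y,z]]=[[x,y],z]+(-1)^{|x||y|}[y,[x,z]]$ for homogeneous $x,y,z$, and $([x,y],z)=(x,[y,z])$ for all $x,y,z$. Then there is a one-to-one correspondence between the set $$\mathcal V=\{\varphi\in\Lambda^3_{\bar 0}(\mathfrak g)\mid \varphi^2\in\mathbb C\}$$ and the set of quadratic Lie superalgebra structures on $\mathfrak g$ with respect to $(\cdot,\cdot)$, under which $\varphi\in\mathcal V$ corresponds to the bracket $$[z_1,z_2]^{\varphi}=2\,\iota(z_1)\iota(z_2)\varphi\qquad(z_1,z_2\in\mathfrak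 g),$$ where $\mathfrak g$ is identified with its image in $\Lambda(\mathfrak g)$. -/

import Mathlib

set_option linter.unusedSectionVars false

noncomputable section

namespace SuperLie

/-- The sign `(-1)^{ij}` attached to two parities `i, j`. -/
def sgn (i j : ZMod 2) : ℂ := (-1) ^ (i.val * j.val)

theorem sgn_comm (i j : ZMod 2) : sgn i j = sgn j i := by
  simp only [sgn, Nat.mul_comm]

theorem sgn_mul_self (i j : ZMod 2) : sgn i j * sgn i j = 1 := by
  simp only [sgn, ← mul_pow]; norm_num

section Space

variable {V : Type*} [AddCommGroup V] [Module ℂ V]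
variable (𝒱 : ZMod 2 → Submodule ℂ V)

/-- A consistent super-symmetric bilinear form on the super vector space
`V = V_0 ⊕ V_1`. -/
structure SuperForm where
  /-- the underlying bilinear form -/
  form : LinearMap.BilinForm ℂ V
  consistent : ∀ i j : ZMod 2, i ≠ j → ∀ x ∈ 𝒱 i, ∀ y ∈ 𝒱 j, form x y = 0
  superSymm : ∀ i j : ZMod 2, ∀ x ∈ 𝒱 i, ∀ y ∈ 𝒱 j, form x y = sgn i j * form y x

namespace SuperForm

/-- The zero form. -/
instance : Zero (SuperForm 𝒱) := ⟨⟨0, by simp, by simp⟩⟩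

/-- The opposite form. -/
instance : Neg (SuperForm 𝒱) :=
  ⟨fun B => ⟨-B.form, fun i j h x hx y hy => by simp [B.consistent i j h x hx y hy],
    fun i j x hx y hy => by simp [B.superSymm i j x hx y hy]⟩⟩

variable {𝒱}

@[simp] theorem zero_form : (0 : SuperForm 𝒱).form = 0 := rfl

@[simp] theorem neg_form (B : SuperForm 𝒱) : (-B).form = -B.form := rfl

end SuperForm

variable {𝒱}

/-- The defining relations `x ⊗ y + (-1)^{|x||y|} y ⊗ x = 2 (x, y)` of the Clifford algebra. -/
inductive CliffordRel (B : SuperForm 𝒱) : TensorAlgebra ℂ V → TensorAlgebra ℂ V → Prop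
  | of {i j : ZMod 2} {x y : V} (hx : x ∈ 𝒱 i) (hy : y ∈ 𝒱 j) :
      CliffordRel B
        (TensorAlgebra.ι ℂ x * TensorAlgebra.ι ℂ y +
          sgn i j • (TensorAlgebra.ι ℂ y * TensorAlgebra.ι ℂ x))
        (algebraMap ℂ _ (2 * B.form x y))

/-- The Clifford algebra `C(V)` of a super vector space with a super-symmetric form. -/
def Clifford (B : SuperForm 𝒱) : Type _ := RingQuot (CliffordRel B)

instance (B : SuperForm 𝒱) : Ring (Clifford B) :=
  inferInstanceAs (Ring (RingQuot (CliffordRel B)))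

instance (B : SuperForm 𝒱) : Algebra ℂ (Clifford B) :=
  inferInstanceAs (Algebra ℂ (RingQuot (CliffordRel B)))

namespace Clifford

/-- The quotient map `T(V) → C(V)`. -/
def mk (B : SuperForm 𝒱) : TensorAlgebra ℂ V →ₐ[ℂ] Clifford B :=
  RingQuot.mkAlgHom ℂ (CliffordRel B)

/-- The canonical map `V → C(V)`. -/
def of (B : SuperForm 𝒱) : V →ₗ[ℂ] Clifford B :=
  (mk B).toLinearMap ∘ₗ TensorAlgebra.ι ℂ

theorem of_mul_of (B : SuperForm 𝒱) {i j : ZMod 2} {x y : V} (hx : x ∈ 𝒱 i) (hy : y ∈ 𝒱 j) :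
    of B x * of B y + sgn i j • (of B y * of B x) = algebraMap ℂ _ (2 * B.form x y) := by
  have h : mk B _ = mk B _ := RingQuot.mkAlgHom_rel ℂ (CliffordRel.of (B := B) hx hy)
  rwa [map_add, map_smul, map_mul, map_mul, AlgHom.commutes] at h

/-- The universal property of the Clifford algebra. -/
def lift (B : SuperForm 𝒱) {A : Type*} [Semiring A] [Algebra ℂ A] (f : V →ₗ[ℂ] A)
    (hf : ∀ i j : ZMod 2, ∀ x ∈ 𝒱 i, ∀ y ∈ 𝒱 j,
      f x * f y + sgn i j • (f y * f x) = algebraMap ℂ A (2 * B.form x y)) :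
    Clifford B →ₐ[ℂ] A :=
  RingQuot.liftAlgHom ℂ ⟨TensorAlgebra.lift ℂ f, by
    rintro _ _ ⟨hx, hy⟩
    simpa only [map_add, map_mul, map_smul, AlgHom.commutes, TensorAlgebra.lift_ι_apply]
      using hf _ _ _ hx _ hy⟩

@[simp] theorem lift_of (B : SuperForm 𝒱) {A : Type*} [Semiring A] [Algebra ℂ A] (f : V →ₗ[ℂ] A)
    (hf : ∀ i j : ZMod 2, ∀ x ∈ 𝒱 i, ∀ y ∈ 𝒱 j,
      f x * f y + sgn i j • (f y * f x) = algebraMap ℂ A (2 * B.form x y)) (x : V) :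
    lift B f hf (of B x) = f x := by
  have h : lift B f hf (of B x) = TensorAlgebra.lift ℂ f (TensorAlgebra.ι ℂ x) :=
    RingQuot.liftAlgHom_mkAlgHom_apply _ _ _ _
  rw [h, TensorAlgebra.lift_ι_apply]

end Clifford

variable (𝒱) [DirectSum.Decomposition 𝒱]

/-- The projection of a super vector space onto its component of parity `i`. -/
def proj (i : ZMod 2) : V →ₗ[ℂ] V :=
  (𝒱 i).subtype ∘ₗ DirectSum.component ℂ (ZMod 2) (fun i => 𝒱 i) i ∘ₗ
    (DirectSum.decomposeLinearEquiv 𝒱).toLinearMap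

/-- The linear map which multiplies `x` of parity `p` by `(-1)^{ip}`. -/
def twist (i : ZMod 2) : V →ₗ[ℂ] V := ∑ p : ZMod 2, sgn i p • proj 𝒱 p

theorem proj_of_mem {i : ZMod 2} (j : ZMod 2) {x : V} (hx : x ∈ 𝒱 i) :
    proj 𝒱 j x = if j = i then x else 0 := by
  have h : proj 𝒱 j x = ((DirectSum.decompose 𝒱 x) j : V) := rfl
  rw [h]
  split_ifs with hij
  · subst hij; exact DirectSum.decompose_of_mem_same 𝒱 hx
  · exact DirectSum.decompose_of_mem_ne 𝒱 hx (Ne.symm hij)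

theorem twist_of_mem (i : ZMod 2) {p : ZMod 2} {x : V} (hx : x ∈ 𝒱 p) :
    twist 𝒱 i x = sgn i p • x := by
  simp [twist, proj_of_mem 𝒱 _ hx]

theorem proj_mem (i : ZMod 2) (x : V) : proj 𝒱 i x ∈ 𝒱 i :=
  ((DirectSum.decompose 𝒱 x) i).2

theorem sum_proj (x : V) : ∑ i : ZMod 2, proj 𝒱 i x = x := by
  induction x using DirectSum.Decomposition.inductionOn 𝒱 with
  | zero => simp
  | homogeneous x => simp [proj_of_mem 𝒱 _ x.2]
  | add x y hx hy => simp only [map_add, Finset.sum_add_distrib, hx, hy]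

theorem twist_mem (i : ZMod 2) {p : ZMod 2} {x : V} (hx : x ∈ 𝒱 p) : twist 𝒱 i x ∈ 𝒱 p := by
  rw [twist_of_mem 𝒱 i hx]; exact Submodule.smul_mem _ _ hx

/-- Linear maps which agree on homogeneous vectors are equal. -/
theorem hom_ext {W : Type*} [AddCommGroup W] [Module ℂ W] {f g : V →ₗ[ℂ] W}
    (h : ∀ k : ZMod 2, ∀ x ∈ 𝒱 k, f x = g x) : f = g := by
  refine LinearMap.ext fun x => ?_
  rw [← sum_proj 𝒱 x, map_sum, map_sum]
  exact Finset.sum_congr rfl fun i _ => h i _ (proj_mem 𝒱 i x)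

variable {𝒱}

namespace Clifford

/-- Induction by left multiplication with homogeneous vectors. -/
theorem induction_left {B : SuperForm 𝒱} {P : Clifford B → Prop}
    (one : P 1) (smul : ∀ (c : ℂ) u, P u → P (c • u)) (add : ∀ u v, P u → P v → P (u + v))
    (of_mul : ∀ i : ZMod 2, ∀ y ∈ 𝒱 i, ∀ u, P u → P (of B y * u)) (u : Clifford B) : P u := by
  have key : ∀ (a : TensorAlgebra ℂ V) (w : Clifford B), P w → P (mk B a * w) := by
    intro a
    induction a using TensorAlgebra.induction with
    | algebraMap r =>
      intro w hw
      rw [AlgHom.commutes, ← Algebra.smul_def]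
      exact smul r w hw
    | ι x =>
      intro w hw
      rw [show mk B (TensorAlgebra.ι ℂ x) = of B x from rfl, ← sum_proj 𝒱 x, map_sum,
        Finset.sum_mul, show (Finset.univ : Finset (ZMod 2)) = {0, 1} from rfl,
        Finset.sum_pair (by decide)]
      exact add _ _ (of_mul 0 _ (proj_mem 𝒱 0 x) w hw) (of_mul 1 _ (proj_mem 𝒱 1 x) w hw)
    | mul a b ha hb =>
      intro w hw
      rw [map_mul, mul_assoc]
      exact ha _ (hb _ hw)
    | add a b ha hb =>
      intro w hw
      rw [map_add, add_mul]
      exact add _ _ (ha _ hw) (hb _ hw)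
  obtain ⟨a, ha⟩ : ∃ a, mk B a = u := RingQuot.mkAlgHom_surjective ℂ (CliffordRel B) u
  have h := key a 1 one
  rwa [mul_one, ha] at h

/-! ### Contractions

The contraction `ι(x)` by a vector `x` with respect to the form `D` is the derivation of degree
`(-1, |x|)` with `ι(x) y = D(x, y)`. It is built from the operators
`y ⬝ (w, f) = (y w, x ↦ D(x, y) w - (-1)^{|x||y|} y f(x))` on pairs consisting of an element `w`
and the family `f` of its contractions. -/

/-- The operator `(w, f) ↦ (y w, x ↦ D(x, y) w - (-1)^{|x||y|} y f(x))`. -/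
def contrAux (B D : SuperForm 𝒱) :
    V →ₗ[ℂ] Module.End ℂ (Clifford B × (V →ₗ[ℂ] Clifford B)) where
  toFun y :=
    LinearMap.prod
      (LinearMap.mulLeft ℂ (of B y) ∘ₗ LinearMap.fst ℂ _ _)
      ((LinearMap.smulRightₗ (D.form.flip y)) ∘ₗ LinearMap.fst ℂ _ _ -
        ∑ i : ZMod 2, (LinearMap.llcomp ℂ V (Clifford B) (Clifford B)
          (LinearMap.mulLeft ℂ (of B (proj 𝒱 i y))) ∘ₗ
            LinearMap.lcomp ℂ (Clifford B) (twist 𝒱 i)) ∘ₗ LinearMap.snd ℂ _ _)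
  map_add' y z := by
    refine LinearMap.ext fun ⟨w, f⟩ => Prod.ext ?_ (LinearMap.ext fun x => ?_)
    · simp [add_mul]
    · simp [add_mul, Finset.sum_add_distrib]; abel
  map_smul' c y := by
    refine LinearMap.ext fun ⟨w, f⟩ => Prod.ext ?_ (LinearMap.ext fun x => ?_)
    · simp
    · simp [smul_sub, Finset.smul_sum]

theorem contrAux_fst (B D : SuperForm 𝒱) (y : V) (w : Clifford B × (V →ₗ[ℂ] Clifford B)) :
    (contrAux B D y w).1 = of B y * w.1 := rfl

theorem contrAux_snd (B D : SuperForm 𝒱) {i : ZMod 2} {y : V} (hy : y ∈ 𝒱 i)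
    (w : Clifford B × (V →ₗ[ℂ] Clifford B)) (x : V) :
    (contrAux B D y w).2 x = D.form x y • w.1 - of B y * w.2 (twist 𝒱 i x) := by
  have h : (contrAux B D y w).2 x =
      D.form x y • w.1 - ∑ j : ZMod 2, of B (proj 𝒱 j y) * w.2 (twist 𝒱 j x) := by
    simp [contrAux]
  rw [h, Finset.sum_eq_single i]
  · rw [proj_of_mem 𝒱 i hy, if_pos rfl]
  · intro j _ hj
    rw [proj_of_mem 𝒱 j hy, if_neg hj, map_zero, zero_mul]
  · simp

theorem contrAux_rel (B D : SuperForm 𝒱) (i j : ZMod 2) (y : V) (hy : y ∈ 𝒱 i) (z : V)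
    (hz : z ∈ 𝒱 j) :
    contrAux B D y * contrAux B D z + sgn i j • (contrAux B D z * contrAux B D y) =
      algebraMap ℂ _ (2 * B.form y z) := by
  refine LinearMap.ext fun w => Prod.ext ?_ (hom_ext 𝒱 fun k x hx => ?_)
  · have h := congrArg (· * w.1) (of_mul_of B hy hz)
    simp only [add_mul, smul_mul_assoc, mul_assoc, ← Algebra.smul_def] at h
    simpa only [LinearMap.add_apply, LinearMap.smul_apply, Module.End.mul_apply, Prod.fst_add,
      Prod.smul_fst, contrAux_fst, Module.algebraMap_end_apply] using h
  · have h := congrArg (· * w.2 x) (of_mul_of B hy hz)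
    simp only [add_mul, smul_mul_assoc, mul_assoc, ← Algebra.smul_def] at h
    simp only [LinearMap.add_apply, LinearMap.smul_apply, Module.End.mul_apply, Prod.snd_add,
      Prod.smul_snd, contrAux_snd B D hy, contrAux_snd B D hz, contrAux_fst,
      Module.algebraMap_end_apply, twist_of_mem 𝒱 _ hx, map_smul, smul_eq_mul]
    have h1 : D.form x y * (1 - sgn i j * sgn j k) = 0 := by
      by_cases hk : k = i
      · rw [hk, sgn_comm j i, sgn_mul_self]; ring
      · rw [D.consistent k i hk x hx y hy]; ring
    have h2 : D.form x z * (sgn i j - sgn i k) = 0 := by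
      by_cases hk : k = j
      · rw [hk]; ring
      · rw [D.consistent k j hk x hx z hz]; ring
    have h3 : sgn i k * sgn j k * (2 * B.form y z) = 2 * B.form y z := by
      by_cases hk : i = j
      · rw [hk, sgn_mul_self]; ring
      · rw [B.consistent i j hk y hy z hz]; ring
    have e1 := congrArg (· • (of B z * w.1)) h1
    have e2 := congrArg (· • (of B y * w.1)) h2
    have e3 := congrArg (fun v => (sgn i k * sgn j k) • v) h
    simp only [← mul_smul, h3] at e3
    simp only [mul_smul, smul_sub, smul_add, mul_sub, mul_smul_comm, zero_smul] at e1 e2 e3 ⊢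
    linear_combination (norm := module) e1 + e2 + e3

/-- The algebra homomorphism extending `contrAux`. -/
def contrLift (B D : SuperForm 𝒱) :
    Clifford B →ₐ[ℂ] Module.End ℂ (Clifford B × (V →ₗ[ℂ] Clifford B)) :=
  lift B (contrAux B D) (contrAux_rel B D)

theorem contrLift_of (B D : SuperForm 𝒱) (y : V) : contrLift B D (of B y) = contrAux B D y :=
  lift_of _ _ _ _

/-- The contractions of an element of the Clifford algebra, as a function of the vector. -/
def contrFlip (B D : SuperForm 𝒱) : Clifford B →ₗ[ℂ] V →ₗ[ℂ] Clifford B where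
  toFun u := (contrLift B D u (1, 0)).2
  map_add' u v := by simp
  map_smul' c u := by simp

/-- The contraction `ι(x)` on `C(V)` with respect to the form `D`: the derivation of degree
`(-1, |x|)` with `ι(x) y = D(x, y)` for `y ∈ V`. -/
def contr (B D : SuperForm 𝒱) : V →ₗ[ℂ] Module.End ℂ (Clifford B) := (contrFlip B D).flip

theorem contr_one (B D : SuperForm 𝒱) (x : V) : contr B D x 1 = 0 := by
  simp [contr, contrFlip]

theorem contrLift_fst (B D : SuperForm 𝒱) (u : Clifford B) :
    (contrLift B D u (1, 0)).1 = u := by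
  induction u using induction_left with
  | one => simp
  | smul c u hu => simp [hu]
  | add u v hu hv => simp [hu, hv]
  | of_mul i y hy u hu => rw [map_mul, contrLift_of, Module.End.mul_apply, contrAux_fst, hu]

theorem contr_of_mul (B D : SuperForm 𝒱) {i j : ZMod 2} {x y : V} (hx : x ∈ 𝒱 i) (hy : y ∈ 𝒱 j)
    (u : Clifford B) :
    contr B D x (of B y * u) = D.form x y • u - sgn i j • (of B y * contr B D x u) := by
  have h : ∀ v, contr B D x v = (contrLift B D v (1, 0)).2 x :=
    fun _ => rfl
  rw [h, h, map_mul, contrLift_of, Module.End.mul_apply, contrAux_snd B D hy, contrLift_fst,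
    twist_of_mem 𝒱 _ hx, map_smul, mul_smul_comm, sgn_comm j i]

theorem contr_contr_pair (B D E : SuperForm 𝒱) {i j : ZMod 2} {x y : V} (hx : x ∈ 𝒱 i)
    (hy : y ∈ 𝒱 j) (u : Clifford B) :
    contr B D x (contr B E y u) + sgn i j • contr B E y (contr B D x u) = 0 := by
  induction u using induction_left with
  | one => simp [contr_one]
  | smul c u hu =>
    simp only [map_smul]
    rw [smul_comm, ← smul_add, hu, smul_zero]
  | add u v hu hv =>
    simp only [map_add, smul_add]
    rw [add_add_add_comm, hu, hv, add_zero]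
  | of_mul k z hz u hu =>
    simp only [contr_of_mul B D hx hz, contr_of_mul B E hy hz, map_sub, map_smul]
    have h1 : E.form y z * (1 - sgn i j * sgn i k) = 0 := by
      by_cases hk : j = k
      · rw [hk, sgn_mul_self]; ring
      · rw [E.consistent j k hk y hy z hz]; ring
    have h2 : D.form x z * (sgn i j - sgn j k) = 0 := by
      by_cases hk : i = k
      · rw [hk, sgn_comm]; ring
      · rw [D.consistent i k hk x hx z hz]; ring
    have e1 := congrArg (· • contr B D x u) h1
    have e2 := congrArg (· • contr B E y u) h2
    have e3 := congrArg (fun v => (sgn i k * sgn j k) • (of B z * v)) hu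
    simp only [mul_smul, smul_sub, sub_smul, smul_add, mul_add, mul_smul_comm, one_smul,
      zero_smul, mul_zero, smul_zero] at e1 e2 e3 ⊢
    linear_combination (norm := module) e1 + e2 + e3

theorem contr_neg_form (B : SuperForm 𝒱) {D D' : SuperForm 𝒱}
    (h : ∀ x z, D'.form x z = -D.form x z) (x : V) (u : Clifford B) :
    contr B D' x u = -contr B D x u := by
  induction u using induction_left generalizing x with
  | one => simp [contr_one]
  | smul c u hu => simp only [map_smul, hu, smul_neg]
  | add u v hu hv => rw [map_add, map_add, hu, hv, neg_add]
  | of_mul k z hz u hu =>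
    rw [← sum_proj 𝒱 x]
    simp only [map_sum, LinearMap.sum_apply, ← Finset.sum_neg_distrib]
    refine Finset.sum_congr rfl fun i _ => ?_
    rw [contr_of_mul B D' (proj_mem 𝒱 i x) hz, contr_of_mul B D (proj_mem 𝒱 i x) hz, h, hu]
    simp only [mul_neg, smul_neg, neg_smul]
    abel

/-! ### Change of form -/

/-- The representation `γ(x) = ε(x) + ι(x)` of `C(V, B)` on `C(V, B')`, where `ε(x)` is left
multiplication by `x`, `ι(x)` is the contraction with respect to `D`, and `B = B' + D`. -/
def gamma (B B' D : SuperForm 𝒱) (h : ∀ x y, B.form x y = B'.form x y + D.form x y) :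
    Clifford B →ₐ[ℂ] Module.End ℂ (Clifford B') :=
  lift B ((LinearMap.mul ℂ (Clifford B')) ∘ₗ of B' + contr B' D) (by
    intro i j x hx y hy
    refine LinearMap.ext fun u => ?_
    have e1 := congrArg (· * u) (of_mul_of B' hx hy)
    have e2 := contr_contr_pair B' D D hx hy u
    have e3 := D.superSymm i j x hx y hy
    have e4 : (sgn i j * sgn i j) • (of B' x * contr B' D y u) = of B' x * contr B' D y u := by
      rw [sgn_mul_self, one_smul]
    have e5 := congrArg (· • u) e3
    simp only [add_mul, smul_mul_assoc, mul_assoc, ← Algebra.smul_def] at e1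
    simp only [LinearMap.add_apply, LinearMap.smul_apply, Module.End.mul_apply,
      LinearMap.comp_apply, LinearMap.mul_apply', Module.algebraMap_end_apply, map_add,
      contr_of_mul B' D hx hy, contr_of_mul B' D hy hx, mul_add, h, sgn_comm j i]
    simp only [mul_smul, smul_sub, smul_add] at e1 e2 e4 e5 ⊢
    rw [two_smul ℂ (D.form x y • u)]
    linear_combination (norm := module) e1 + e2 - e4 - e5)

/-- The linear map `u ↦ γ(u) 1` from `C(V, B)` to `C(V, B')`. -/
def changeForm (B B' D : SuperForm 𝒱) (h : ∀ x y, B.form x y = B'.form x y + D.form x y) :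
    Clifford B →ₗ[ℂ] Clifford B' :=
  LinearMap.applyₗ (1 : Clifford B') ∘ₗ (gamma B B' D h).toLinearMap

section

variable {B B' D : SuperForm 𝒱} (h : ∀ x y, B.form x y = B'.form x y + D.form x y)

theorem changeForm_one : changeForm B B' D h 1 = 1 := by simp [changeForm]

theorem changeForm_of_mul (x : V) (u : Clifford B) :
    changeForm B B' D h (of B x * u) =
      of B' x * changeForm B B' D h u + contr B' D x (changeForm B B' D h u) := by
  simp [changeForm, gamma]

theorem changeForm_contr (E : SuperForm 𝒱) {i : ZMod 2} {x : V} (hx : x ∈ 𝒱 i) (u : Clifford B) :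
    changeForm B B' D h (contr B E x u) = contr B' E x (changeForm B B' D h u) := by
  induction u using induction_left with
  | one => simp [contr_one, changeForm_one]
  | smul c u hu => simp only [map_smul, hu]
  | add u v hu hv => simp only [map_add, hu, hv]
  | of_mul j y hy u hu =>
    have e1 := contr_contr_pair B' E D hx hy (changeForm B B' D h u)
    rw [contr_of_mul B E hx hy, changeForm_of_mul, map_sub, map_smul, map_smul, map_add,
      changeForm_of_mul, contr_of_mul B' E hx hy, hu]
    linear_combination (norm := module) - e1

end

theorem changeForm_changeForm {B B' D D' : SuperForm 𝒱}
    (h : ∀ x y, B.form x y = B'.form x y + D.form x y)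
    (h' : ∀ x y, B'.form x y = B.form x y + D'.form x y) (u : Clifford B) :
    changeForm B' B D' h' (changeForm B B' D h u) = u := by
  induction u using induction_left with
  | one => simp [changeForm_one]
  | smul c u hu => simp only [map_smul, hu]
  | add u v hu hv => simp only [map_add, hu, hv]
  | of_mul j y hy u hu =>
    rw [changeForm_of_mul, map_add, changeForm_of_mul, changeForm_contr h' D hy, hu]
    have hD : ∀ x z, D'.form x z = -D.form x z := fun x z => by
      linear_combination -h x z - h' x z
    rw [contr_neg_form B hD y u]
    abel

end Clifford

variable (B : SuperForm 𝒱)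

/-- The exterior algebra `Λ(V)` of a super vector space: the algebra generated by `V` with the
relations `x ∧ y + (-1)^{|x||y|} y ∧ x = 0`. -/
abbrev Exterior (𝒱 : ZMod 2 → Submodule ℂ V) : Type _ := Clifford (0 : SuperForm 𝒱)

namespace Exterior

/-- The canonical map `V → Λ(V)`. -/
abbrev of (𝒱 : ZMod 2 → Submodule ℂ V) : V →ₗ[ℂ] Exterior 𝒱 := Clifford.of (0 : SuperForm 𝒱)

theorem of_mul_of {i j : ZMod 2} {x y : V} (hx : x ∈ 𝒱 i) (hy : y ∈ 𝒱 j) :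
    of 𝒱 x * of 𝒱 y + sgn i j • (of 𝒱 y * of 𝒱 x) = 0 := by
  simpa using Clifford.of_mul_of (0 : SuperForm 𝒱) hx hy

/-- The contraction `ι(x)` on `Λ(V)`. -/
def contr : V →ₗ[ℂ] Module.End ℂ (Exterior 𝒱) := Clifford.contr 0 B

theorem contr_one (x : V) : contr B x 1 = 0 := Clifford.contr_one 0 B x

/-- The contraction by `x` is a derivation of degree `(-1, |x|)` with `ι(x) y = (x, y)`. -/
theorem contr_of_mul {i j : ZMod 2} {x y : V} (hx : x ∈ 𝒱 i) (hy : y ∈ 𝒱 j) (u : Exterior 𝒱) :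
    contr B x (of 𝒱 y * u) = B.form x y • u - sgn i j • (of 𝒱 y * contr B x u) :=
  Clifford.contr_of_mul 0 B hx hy u

/-- The homogeneous component `Λ^n_a(V)`, spanned by the products `x₁ ∧ ⋯ ∧ xₙ` of homogeneous
vectors whose parities add up to `a`. -/
def component (𝒱 : ZMod 2 → Submodule ℂ V) (n : ℕ) (a : ZMod 2) : Submodule ℂ (Exterior 𝒱) :=
  Submodule.span ℂ {u | ∃ (p : Fin n → ZMod 2) (x : Fin n → V), (∀ k, x k ∈ 𝒱 (p k)) ∧
    ∑ k, p k = a ∧ u = (List.ofFn fun k => of 𝒱 (x k)).prod}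

end Exterior

/-- The action `γ : C(V) → End Λ(V)`, `γ(x) = ε(x) + ι(x)` for `x ∈ V`, where `ε(x)` is left
exterior multiplication by `x`. -/
def cliffordAction : Clifford B →ₐ[ℂ] Module.End ℂ (Exterior 𝒱) :=
  Clifford.gamma B 0 B (by simp)

theorem cliffordAction_of (x : V) (u : Exterior 𝒱) :
    cliffordAction B (Clifford.of B x) u = Exterior.of 𝒱 x * u + Exterior.contr B x u := by
  simp [cliffordAction, Clifford.gamma, Exterior.contr]

/-- The linear isomorphism `η : C(V) ≃ Λ(V)`, `η(u) = γ(u) 1`, by which the two algebras are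
identified. -/
def eta : Clifford B ≃ₗ[ℂ] Exterior 𝒱 where
  toFun u := cliffordAction B u 1
  map_add' u v := by simp
  map_smul' c u := by simp
  invFun := Clifford.changeForm 0 B (-B) (by simp)
  left_inv u := Clifford.changeForm_changeForm (by simp) (by simp) u
  right_inv u := Clifford.changeForm_changeForm (by simp) (by simp) u

theorem eta_apply (u : Clifford B) : eta B u = cliffordAction B u 1 := rfl

/-- The Clifford product on `Λ(V)`, transported from `C(V)` by `η`. -/
def cliffordMul (u v : Exterior 𝒱) : Exterior 𝒱 := eta B ((eta B).symm u * (eta B).symm v)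

/-- The set of the even cubic elements `φ ∈ Λ³_0(V)` whose Clifford square is a scalar. -/
def scalarSquareCubics : Set (Exterior 𝒱) :=
  {φ | φ ∈ Exterior.component 𝒱 3 0 ∧ ∃ c : ℂ, cliffordMul B φ φ = algebraMap ℂ (Exterior 𝒱) c}

end Space

/-- A Lie superalgebra structure on the super vector space `V = V_0 ⊕ V_1`. -/
structure LieSuperStructure {V : Type*} [AddCommGroup V] [Module ℂ V]
    (𝒱 : ZMod 2 → Submodule ℂ V) where
  /-- the bracket -/
  bracket : V →ₗ[ℂ] V →ₗ[ℂ] V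
  bracket_mem : ∀ i j : ZMod 2, ∀ x ∈ 𝒱 i, ∀ y ∈ 𝒱 j, bracket x y ∈ 𝒱 (i + j)
  skew : ∀ i j : ZMod 2, ∀ x ∈ 𝒱 i, ∀ y ∈ 𝒱 j, bracket x y = -(sgn j i • bracket y x)
  jacobi : ∀ i j k : ZMod 2, ∀ x ∈ 𝒱 i, ∀ y ∈ 𝒱 j, ∀ z ∈ 𝒱 k,
    bracket x (bracket y z) = bracket (bracket x y) z + sgn j i • bracket y (bracket x z)

/-- A quadratic Lie superalgebra structure on `V` with respect to the form `B`: a Lie superalgebra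
structure for which `B` is invariant. -/
structure QuadraticLieSuperStructure {V : Type*} [AddCommGroup V] [Module ℂ V]
    {𝒱 : ZMod 2 → Submodule ℂ V} (B : SuperForm 𝒱) extends LieSuperStructure 𝒱 where
  invariant : ∀ x y z : V, B.form (bracket x y) z = B.form x (bracket y z)

end SuperLie

end

set_option linter.unusedSectionVars false

noncomputable section

namespace SuperLie

theorem sgn_zero_right (i : ZMod 2) : sgn i 0 = 1 := by simp [sgn]

theorem sgn_add_right (i j k : ZMod 2) : sgn i (j + k) = sgn i j * sgn i k := by
  have h : ∀ a b c : ZMod 2, (a.val * (b + c).val) % 2 = (a.val * b.val + a.val * c.val) % 2 := by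
    decide
  rw [sgn, sgn, sgn, ← pow_add, neg_one_pow_eq_pow_mod_two, h, ← neg_one_pow_eq_pow_mod_two]

theorem sgn_one_ne {i j : ZMod 2} (h : i ≠ j) : sgn 1 i ≠ sgn 1 j := by
  have h1 : (1 : ZMod 2).val = 1 := rfl
  have h2 : (0 : ZMod 2).val = 0 := rfl
  have h3 : ∀ a : ZMod 2, a = 0 ∨ a = 1 := by decide
  rcases h3 i with rfl | rfl <;> rcases h3 j with rfl | rfl
  · exact absurd rfl h
  · norm_num [sgn, h1, h2]
  · norm_num [sgn, h1, h2]
  · exact absurd rfl h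

section

variable {V : Type*} [AddCommGroup V] [Module ℂ V] {𝒱 : ZMod 2 → Submodule ℂ V}

theorem SuperForm.form_mul_sgn (B : SuperForm 𝒱) (k : ZMod 2) {i j : ZMod 2} {x y : V}
    (hx : x ∈ 𝒱 i) (hy : y ∈ 𝒱 j) : sgn k i * B.form x y = sgn k j * B.form x y := by
  by_cases h : i = j
  · rw [h]
  · rw [B.consistent i j h x hx y hy, mul_zero, mul_zero]

variable [DirectSum.Decomposition 𝒱]

theorem mem_of_twist_one {k : ZMod 2} {v : V} (h : twist 𝒱 1 v = sgn 1 k • v) : v ∈ 𝒱 k := by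
  have key : ∀ i, i ≠ k → proj 𝒱 i v = 0 := by
    intro i hi
    have h1 : proj 𝒱 i (twist 𝒱 1 v) = sgn 1 i • proj 𝒱 i v := by
      simp only [twist, LinearMap.sum_apply, LinearMap.smul_apply, map_sum, map_smul]
      rw [Finset.sum_eq_single i]
      · rw [proj_of_mem 𝒱 i (proj_mem 𝒱 i v), if_pos rfl]
      · intro j _ hj
        rw [proj_of_mem 𝒱 i (proj_mem 𝒱 j v), if_neg (Ne.symm hj), smul_zero]
      · simp
    rw [h, map_smul] at h1
    have h2 : (sgn 1 k - sgn 1 i) • proj 𝒱 i v = 0 := by rw [sub_smul, h1, sub_self]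
    exact (smul_eq_zero.mp h2).resolve_left (sub_ne_zero.mpr (sgn_one_ne (Ne.symm hi)))
  rw [← sum_proj 𝒱 v, Finset.sum_eq_single k (fun i _ hi => key i hi) (by simp)]
  exact proj_mem 𝒱 k v

theorem SuperForm.form_proj_left (B : SuperForm 𝒱) (i : ZMod 2) (x y : V) :
    B.form (proj 𝒱 i x) y = B.form x (proj 𝒱 i y) := by
  have h1 : B.form (proj 𝒱 i x) y = B.form (proj 𝒱 i x) (proj 𝒱 i y) := by
    conv_lhs => rw [← sum_proj 𝒱 y, map_sum]
    exact Finset.sum_eq_single i (fun j _ hj => B.consistent i j (Ne.symm hj) _ (proj_mem 𝒱 i x) _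
      (proj_mem 𝒱 j y)) (by simp)
  have h2 : B.form x (proj 𝒱 i y) = B.form (proj 𝒱 i x) (proj 𝒱 i y) := by
    conv_lhs => rw [← sum_proj 𝒱 x, map_sum, LinearMap.sum_apply]
    exact Finset.sum_eq_single i (fun j _ hj => B.consistent j i hj _ (proj_mem 𝒱 j x) _
      (proj_mem 𝒱 i y)) (by simp)
  rw [h1, h2]

/-! ### Sign automorphisms and supercommutators -/

namespace Clifford

/-- The automorphism `y ↦ -(-1)^{i|y|} y` of the Clifford algebra. -/
def signAut (B : SuperForm 𝒱) (i : ZMod 2) : Clifford B →ₐ[ℂ] Clifford B :=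
  lift B (-(of B ∘ₗ twist 𝒱 i)) (by
    intro a b x hx y hy
    have h := congrArg (fun u => (sgn i a * sgn i b) • u) (of_mul_of B hx hy)
    have hs : sgn i a * sgn i b * B.form x y = B.form x y := by
      rw [mul_assoc, ← B.form_mul_sgn i hx hy, ← mul_assoc, sgn_mul_self, one_mul]
    simp only [Algebra.algebraMap_eq_smul_one, ← mul_smul] at h ⊢
    rw [show sgn i a * sgn i b * (2 * B.form x y) = 2 * B.form x y by
      linear_combination 2 * hs] at h
    rw [← h]
    simp only [LinearMap.neg_apply, LinearMap.comp_apply, twist_of_mem 𝒱 i hx,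
      twist_of_mem 𝒱 i hy, map_smul, neg_mul_neg, smul_mul_smul_comm]
    module)

theorem signAut_of (B : SuperForm 𝒱) (i : ZMod 2) {j : ZMod 2} {y : V} (hy : y ∈ 𝒱 j) :
    signAut B i (of B y) = -(sgn i j • of B y) := by
  simp [signAut, twist_of_mem 𝒱 i hy]

/-- The contraction by `x` as a supercommutator with `x / 2`. -/
theorem of_mul_eq (B : SuperForm 𝒱) {i : ZMod 2} {x : V} (hx : x ∈ 𝒱 i) (u : Clifford B) :
    of B x * u = (2 : ℂ) • contr B B x u + signAut B i u * of B x := by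
  induction u using induction_left with
  | one => simp [contr_one]
  | smul c u hu => simp only [mul_smul_comm, hu, map_smul, smul_add, smul_mul_assoc, smul_comm c]
  | add u v hu hv => simp only [mul_add, hu, hv, map_add, smul_add, add_mul]; abel
  | of_mul j y hy u hu =>
    have e1 := congrArg (· * u) (of_mul_of B hx hy)
    have e2 := congrArg (fun w => sgn i j • (of B y * w)) hu
    simp only [add_mul, smul_mul_assoc, mul_assoc, ← Algebra.smul_def, mul_add, mul_smul_comm,
      smul_add] at e1 e2
    rw [contr_of_mul B B hx hy, map_mul, signAut_of B i hy]
    simp only [neg_mul, smul_mul_assoc, mul_assoc]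
    linear_combination (norm := module) e1 - e2

theorem contr_signAut (B D : SuperForm 𝒱) (i : ZMod 2) {j : ZMod 2} {x : V} (hx : x ∈ 𝒱 j)
    (u : Clifford B) :
    contr B D x (signAut B i u) = -(sgn i j • signAut B i (contr B D x u)) := by
  induction u using induction_left with
  | one => simp [contr_one]
  | smul c u hu => simp only [map_smul, hu, smul_neg, smul_comm c]
  | add u v hu hv => simp only [map_add, hu, hv, smul_add]; abel
  | of_mul k y hy u hu =>
    have e := congrArg (· • signAut B i u) (D.form_mul_sgn i hx hy)
    simp only [mul_smul] at e
    simp only [map_mul, signAut_of B i hy, neg_mul, smul_mul_assoc, map_neg, map_smul,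
      contr_of_mul B D hx hy, hu, map_sub, mul_neg, mul_smul_comm]
    linear_combination (norm := module) e

theorem changeForm_signAut {B B' D : SuperForm 𝒱}
    (h : ∀ x y, B.form x y = B'.form x y + D.form x y) (i : ZMod 2) (u : Clifford B) :
    changeForm B B' D h (signAut B i u) = signAut B' i (changeForm B B' D h u) := by
  induction u using induction_left with
  | one => simp [changeForm_one]
  | smul c u hu => simp only [map_smul, hu]
  | add u v hu hv => simp only [map_add, hu, hv]
  | of_mul j y hy u hu =>
    simp only [map_mul, map_add, signAut_of _ i hy, neg_mul, smul_mul_assoc, map_neg, map_smul,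
      changeForm_of_mul, hu, contr_signAut B' D i hy]
    have e : (sgn i j * sgn i j) • signAut B' i (contr B' D y (changeForm B B' D h u)) =
        signAut B' i (contr B' D y (changeForm B B' D h u)) := by
      rw [sgn_mul_self, one_smul]
    linear_combination (norm := module) e

end Clifford

/-! ### Homogeneous dual families and the Euler operator -/

/-- A pair of homogeneous families of vectors dual to each other with respect to `B`. -/
structure DualFamily (B : SuperForm 𝒱) (κ : Type*) [Fintype κ] where
  /-- the first family -/
  e : κ → V
  /-- the dual family -/
  e' : κ → V
  /-- the common parity -/
  par : κ → ZMod 2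
  mem : ∀ k, e k ∈ 𝒱 (par k)
  mem' : ∀ k, e' k ∈ 𝒱 (par k)
  sum_left : ∀ y, ∑ k, B.form (e' k) y • e k = y
  sum_right : ∀ z, ∑ k, B.form z (e k) • e' k = z

theorem exists_dualFamily [FiniteDimensional ℂ V] (B : SuperForm 𝒱) (hB : B.form.Nondegenerate) :
    Nonempty (DualFamily B (ZMod 2 × Fin (Module.finrank ℂ V))) := by
  let b := Module.finBasis ℂ V
  let b' := B.form.dualBasis hB b
  have h1 : ∀ y, ∑ l, B.form (b' l) y • b l = y := by
    intro y
    conv_rhs => rw [← b.sum_repr y]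
    refine Finset.sum_congr rfl fun l _ => ?_
    congr 1
    have h : B.form (b' l) = b.coord l := by
      refine b.ext fun m => ?_
      rw [LinearMap.BilinForm.apply_dualBasis_left, Module.Basis.coord_apply,
        Module.Basis.repr_self, Finsupp.single_apply]
    rw [h, Module.Basis.coord_apply]
  have h2 : ∀ z, ∑ l, B.form z (b l) • b' l = z := by
    intro z
    conv_rhs => rw [← b'.sum_repr z]
    simp [b', LinearMap.BilinForm.dualBasis_repr_apply]
  refine ⟨⟨fun k => proj 𝒱 k.1 (b k.2), fun k => proj 𝒱 k.1 (b' k.2), fun k => k.1,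
    fun k => proj_mem 𝒱 _ _, fun k => proj_mem 𝒱 _ _, fun y => ?_, fun z => ?_⟩⟩
  · rw [Fintype.sum_prod_type]
    simp only [SuperForm.form_proj_left, ← map_smul, ← map_sum]
    conv_rhs => rw [← sum_proj 𝒱 y]
    refine Finset.sum_congr rfl fun i _ => ?_
    rw [h1, proj_of_mem 𝒱 i (proj_mem 𝒱 i y), if_pos rfl]
  · rw [Fintype.sum_prod_type]
    simp only [← SuperForm.form_proj_left, ← map_smul, ← map_sum]
    conv_rhs => rw [← sum_proj 𝒱 z]
    refine Finset.sum_congr rfl fun i _ => ?_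
    rw [h2, proj_of_mem 𝒱 i (proj_mem 𝒱 i z), if_pos rfl]

namespace Exterior

/-- The augmentation `Λ(V) → ℂ` which kills `V`. -/
def counit (𝒱 : ZMod 2 → Submodule ℂ V) [DirectSum.Decomposition 𝒱] : Exterior 𝒱 →ₐ[ℂ] ℂ :=
  Clifford.lift 0 0 (by simp)

theorem counit_of_mul (x : V) (u : Exterior 𝒱) : counit 𝒱 (of 𝒱 x * u) = 0 := by
  simp [counit]

theorem contr_of (B : SuperForm 𝒱) (x y : V) :
    contr B x (of 𝒱 y) = B.form x y • (1 : Exterior 𝒱) := by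
  have h : (contr B).flip (of 𝒱 y) = (LinearMap.smulRightₗ (B.form.flip y)) 1 := by
    rw [← sum_proj 𝒱 y]
    simp only [map_sum, LinearMap.sum_apply]
    refine Finset.sum_congr rfl fun j _ => hom_ext 𝒱 fun k x hx => ?_
    have h1 := contr_of_mul B hx (proj_mem 𝒱 j y) (1 : Exterior 𝒱)
    rw [mul_one, contr_one, mul_zero, smul_zero, sub_zero] at h1
    simpa using h1
  simpa using LinearMap.congr_fun h x

variable {B : SuperForm 𝒱} {κ : Type*} [Fintype κ]

/-- The Euler operator on the exterior algebra. -/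
def euler (F : DualFamily B κ) : Module.End ℂ (Exterior 𝒱) :=
  ∑ k, LinearMap.mulLeft ℂ (of 𝒱 (F.e k)) ∘ₗ contr B (F.e' k)

theorem euler_apply (F : DualFamily B κ) (u : Exterior 𝒱) : euler F u = ∑ k, of 𝒱 (F.e k) * contr B (F.e' k) u := by
  simp [euler]

theorem euler_of_mul (F : DualFamily B κ) {j : ZMod 2} {y : V} (hy : y ∈ 𝒱 j) (u : Exterior 𝒱) :
    euler F (of 𝒱 y * u) = of 𝒱 y * u + of 𝒱 y * euler F u := by
  have h : of 𝒱 y * u = ∑ k, B.form (F.e' k) y • (of 𝒱 (F.e k) * u) := by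
    conv_lhs => rw [← F.sum_left y]
    simp only [map_sum, map_smul, Finset.sum_mul, smul_mul_assoc]
  rw [euler_apply, euler_apply, Finset.mul_sum]
  conv_rhs => rw [h, ← Finset.sum_add_distrib]
  refine Finset.sum_congr rfl fun k _ => ?_
  have e := congrArg (· * contr B (F.e' k) u) (of_mul_of (F.mem k) hy)
  simp only [add_mul, smul_mul_assoc, mul_assoc, zero_mul] at e
  have e2 := congrArg (fun w => sgn (F.par k) j • w) e
  have hs := sgn_mul_self (F.par k) j
  simp only [smul_add, ← mul_smul, hs, one_smul, smul_zero] at e2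
  rw [contr_of_mul B (F.mem' k) hy, mul_sub, mul_smul_comm, mul_smul_comm]
  linear_combination (norm := module) -e2

/-- Every element of the exterior algebra is the sum of a scalar and eigenvectors of the Euler
operator for non-zero eigenvalues. -/
theorem exists_scalar_add_mem (F : DualFamily B κ) (u : Exterior 𝒱) :
    ∃ c : ℂ, ∃ v ∈ ⨆ μ ≠ (0 : ℂ), (euler F).eigenspace μ, u = algebraMap ℂ _ c + v := by
  suffices h : ∃ c : ℂ, ∃ v ∈ ⨆ n : ℕ, (euler F).eigenspace ((n : ℂ) + 1),
      u = algebraMap ℂ _ c + v by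
    obtain ⟨c, v, hv, rfl⟩ := h
    refine ⟨c, v, ?_, rfl⟩
    have hle : ⨆ n : ℕ, (euler F).eigenspace ((n : ℂ) + 1) ≤
        ⨆ μ ≠ (0 : ℂ), (euler F).eigenspace μ :=
      iSup_le fun n => le_iSup₂_of_le ((n : ℂ) + 1) (Nat.cast_add_one_ne_zero n) le_rfl
    exact hle hv
  induction u using Clifford.induction_left with
  | one => exact ⟨1, 0, zero_mem _, by simp⟩
  | smul a u hu =>
    obtain ⟨c, v, hv, rfl⟩ := hu
    exact ⟨a * c, a • v, Submodule.smul_mem _ _ hv, by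
      rw [smul_add, map_mul, ← Algebra.smul_def]⟩
  | add u w hu hw =>
    obtain ⟨c, v, hv, rfl⟩ := hu
    obtain ⟨c', v', hv', rfl⟩ := hw
    exact ⟨c + c', v + v', add_mem hv hv', by rw [map_add]; abel⟩
  | of_mul j y hy u hu =>
    obtain ⟨c, v, hv, rfl⟩ := hu
    refine ⟨0, of 𝒱 y * (algebraMap ℂ _ c + v), ?_, by simp⟩
    rw [mul_add]
    refine add_mem (Submodule.mem_iSup_of_mem 0 ?_) ?_
    · rw [Module.End.mem_eigenspace_iff, euler_of_mul F hy, euler_apply]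
      simp [Algebra.algebraMap_eq_smul_one, contr_one]
    · induction hv using Submodule.iSup_induction' with
      | mem n v hv =>
        refine Submodule.mem_iSup_of_mem (n + 1) ?_
        rw [Module.End.mem_eigenspace_iff] at hv ⊢
        rw [euler_of_mul F hy, hv, mul_smul_comm]
        push_cast
        module
      | zero => simp
      | add v w _ _ hv hw => rw [mul_add]; exact add_mem hv hw

/-- An element killed by all contractions is a scalar. -/
theorem exists_eq_algebraMap (F : DualFamily B κ) (u : Exterior 𝒱) (hu : ∀ x, contr B x u = 0) :
    ∃ c : ℂ, u = algebraMap ℂ _ c := by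
  obtain ⟨c, v, hv, rfl⟩ := exists_scalar_add_mem F u
  refine ⟨c, ?_⟩
  have h0 : v ∈ (euler F).eigenspace 0 := by
    rw [Module.End.mem_eigenspace_iff, zero_smul, euler_apply]
    refine Finset.sum_eq_zero fun k _ => ?_
    have h := hu (F.e' k)
    rw [map_add, Algebra.algebraMap_eq_smul_one, map_smul, contr_one, smul_zero, zero_add] at h
    rw [h, mul_zero]
  have h1 := (Submodule.disjoint_def.mp ((Module.End.eigenspaces_iSupIndep (euler F)) 0)) v h0 hv
  rw [h1, add_zero]

theorem eq_zero_of_contr_eq_zero (F : DualFamily B κ) (u : Exterior 𝒱) (hu : ∀ x, contr B x u = 0)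
    (h : counit 𝒱 u = 0) : u = 0 := by
  obtain ⟨c, rfl⟩ := exists_eq_algebraMap F u hu
  rw [AlgHom.commutes] at h
  rw [show c = 0 from h, map_zero]

/-- The projection of `Λ(V)` onto `V`. -/
def toVector (F : DualFamily B κ) : Exterior 𝒱 →ₗ[ℂ] V :=
  ∑ k, ((counit 𝒱).toLinearMap ∘ₗ contr B (F.e' k)).smulRight (F.e k)

theorem toVector_of (F : DualFamily B κ) (v : V) : toVector F (of 𝒱 v) = v := by
  have h : toVector F (of 𝒱 v) = ∑ k, B.form (F.e' k) v • F.e k := by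
    simp [toVector, contr_of]
  rw [h, F.sum_left]

theorem of_injective (F : DualFamily B κ) : Function.Injective (of 𝒱) :=
  Function.LeftInverse.injective (toVector_of F)

end Exterior

end

end SuperLie

namespace SuperLie

section

variable {V : Type*} [AddCommGroup V] [Module ℂ V] {𝒱 : ZMod 2 → Submodule ℂ V}
  [DirectSum.Decomposition 𝒱]

namespace Exterior

/-! ### Elements of degrees two and three -/

/-- The span of the products of two homogeneous vectors. -/
def quadratic (𝒱 : ZMod 2 → Submodule ℂ V) : Submodule ℂ (Exterior 𝒱) :=
  Submodule.span ℂ {u | ∃ (i j : ZMod 2) (a b : V), a ∈ 𝒱 i ∧ b ∈ 𝒱 j ∧ u = of 𝒱 a * of 𝒱 b}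

theorem component_three_induction {a : ZMod 2} {P : Exterior 𝒱 → Prop} (zero : P 0)
    (add : ∀ u v, P u → P v → P (u + v)) (smul : ∀ (c : ℂ) u, P u → P (c • u))
    (prod : ∀ i j k : ZMod 2, i + j + k = a → ∀ x ∈ 𝒱 i, ∀ y ∈ 𝒱 j, ∀ z ∈ 𝒱 k,
      P (of 𝒱 x * (of 𝒱 y * of 𝒱 z))) {u : Exterior 𝒱} (hu : u ∈ component 𝒱 3 a) : P u := by
  induction hu using Submodule.span_induction with
  | mem u hu =>
    obtain ⟨p, x, hx, hp, rfl⟩ := hu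
    have h := prod _ _ _ (by rw [← hp, Fin.sum_univ_three]) _ (hx 0) _ (hx 1) _ (hx 2)
    simpa [List.ofFn_succ] using h
  | zero => exact zero
  | add u v _ _ hu hv => exact add u v hu hv
  | smul c u _ hu => exact smul c u hu

theorem mul_mul_mem_component_three {a i j k : ZMod 2} (h : i + j + k = a) {x y z : V}
    (hx : x ∈ 𝒱 i) (hy : y ∈ 𝒱 j) (hz : z ∈ 𝒱 k) :
    of 𝒱 x * (of 𝒱 y * of 𝒱 z) ∈ component 𝒱 3 a := by
  refine Submodule.subset_span ⟨![i, j, k], ![x, y, z], ?_, ?_, ?_⟩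
  · intro l
    fin_cases l
    exacts [hx, hy, hz]
  · simpa [Fin.sum_univ_three] using h
  · simp [List.ofFn_succ]

variable (B : SuperForm 𝒱)

theorem signAut_cubic (i : ZMod 2) {φ : Exterior 𝒱} (hφ : φ ∈ component 𝒱 3 0) :
    Clifford.signAut 0 i φ = -φ := by
  refine component_three_induction (P := fun φ => Clifford.signAut 0 i φ = -φ) ?_
    (fun u v hu hv => ?_) (fun c u hu => ?_)
    (fun i' j' k' h x hx y hy z hz => ?_) hφ
  · simp
  · rw [map_add, hu, hv, neg_add]
  · rw [map_smul, hu, smul_neg]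
  · have hs : sgn i i' * sgn i j' * sgn i k' = 1 := by
      rw [← sgn_add_right, ← sgn_add_right, h, sgn_zero_right]
    simp only [map_mul, Clifford.signAut_of _ i hx, Clifford.signAut_of _ i hy,
      Clifford.signAut_of _ i hz, neg_mul, mul_neg, smul_mul_assoc, mul_smul_comm, smul_neg]
    have e := congrArg (· • (of 𝒱 x * (of 𝒱 y * of 𝒱 z))) hs
    linear_combination (norm := module) -e

theorem counit_cubic {a : ZMod 2} {φ : Exterior 𝒱} (hφ : φ ∈ component 𝒱 3 a) :
    counit 𝒱 φ = 0 := by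
  refine component_three_induction (P := fun φ => counit 𝒱 φ = 0) ?_
    (fun u v hu hv => ?_) (fun c u hu => ?_)
    (fun i' j' k' h x hx y hy z hz => ?_) hφ
  · simp
  · rw [map_add, hu, hv, add_zero]
  · rw [map_smul, hu, smul_zero]
  · exact counit_of_mul _ _

theorem counit_quadratic {u : Exterior 𝒱} (hu : u ∈ quadratic 𝒱) : counit 𝒱 u = 0 := by
  induction hu using Submodule.span_induction with
  | mem u hu =>
    obtain ⟨i, j, a, b, -, -, rfl⟩ := hu
    exact counit_of_mul _ _
  | zero => simp
  | add u v _ _ hu hv => rw [map_add, hu, hv, add_zero]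
  | smul c u _ hu => rw [map_smul, hu, smul_zero]

theorem contr_cubic_mem {a : ZMod 2} {φ : Exterior 𝒱} (hφ : φ ∈ component 𝒱 3 a) (w : V) :
    contr B w φ ∈ quadratic 𝒱 := by
  rw [← sum_proj 𝒱 w, map_sum, LinearMap.sum_apply]
  refine Submodule.sum_mem _ fun l _ => ?_
  have hw := proj_mem 𝒱 l w
  refine component_three_induction (P := fun φ => contr B (proj 𝒱 l w) φ ∈ quadratic 𝒱) ?_
    (fun u v hu hv => ?_) (fun c u hu => ?_)
    (fun i' j' k' h x hx y hy z hz => ?_) hφ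
  · simp
  · rw [map_add]; exact add_mem hu hv
  · rw [map_smul]; exact Submodule.smul_mem _ _ hu
  · rw [contr_of_mul B hw hx, contr_of_mul B hw hy, contr_of, mul_sub, mul_smul_comm,
      mul_smul_comm, mul_smul_comm, mul_one]
    refine sub_mem (Submodule.smul_mem _ _ (Submodule.subset_span ⟨_, _, _, _, hy, hz, rfl⟩))
      (Submodule.smul_mem _ _ (sub_mem ?_ ?_))
    · exact Submodule.smul_mem _ _ (Submodule.subset_span ⟨_, _, _, _, hx, hz, rfl⟩)
    · rw [mul_smul_comm]
      exact Submodule.smul_mem _ _ (Submodule.smul_mem _ _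
        (Submodule.subset_span ⟨_, _, _, _, hx, hy, rfl⟩))

theorem contr_quadratic_mem {u : Exterior 𝒱} (hu : u ∈ quadratic 𝒱) (w : V) :
    contr B w u ∈ LinearMap.range (of 𝒱) := by
  rw [← sum_proj 𝒱 w, map_sum, LinearMap.sum_apply]
  refine Submodule.sum_mem _ fun l _ => ?_
  induction hu using Submodule.span_induction with
  | mem u hu =>
    obtain ⟨i, j, a, b, ha, hb, rfl⟩ := hu
    rw [contr_of_mul B (proj_mem 𝒱 l w) ha, contr_of, mul_smul_comm, mul_one]
    exact sub_mem (Submodule.smul_mem _ _ ⟨b, rfl⟩)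
      (Submodule.smul_mem _ _ (Submodule.smul_mem _ _ ⟨a, rfl⟩))
  | zero => simp
  | add u v _ _ hu hv => rw [map_add]; exact add_mem hu hv
  | smul c u _ hu => rw [map_smul]; exact Submodule.smul_mem _ _ hu

end Exterior

/-! ### Transport to the Clifford algebra -/

namespace Clifford

variable (B : SuperForm 𝒱)

theorem eta_one : eta B 1 = 1 := by simp [eta_apply]

theorem eta_algebraMap (c : ℂ) : eta B (algebraMap ℂ _ c) = algebraMap ℂ _ c := by
  rw [Algebra.algebraMap_eq_smul_one, Algebra.algebraMap_eq_smul_one, map_smul, eta_one]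

theorem eta_of_mul (x : V) (u : Clifford B) :
    eta B (of B x * u) = Exterior.of 𝒱 x * eta B u + Exterior.contr B x (eta B u) :=
  changeForm_of_mul (B := B) (B' := 0) (D := B) (by simp) x u

theorem eta_of (x : V) : eta B (of B x) = Exterior.of 𝒱 x := by
  rw [← mul_one (of B x), eta_of_mul, eta_one, Exterior.contr_one, mul_one, add_zero]

theorem eta_of_mul_of (x y : V) :
    eta B (of B x * of B y) = Exterior.of 𝒱 x * Exterior.of 𝒱 y + B.form x y • 1 := by
  rw [eta_of_mul, eta_of, Exterior.contr_of]

theorem eta_contr (x : V) (u : Clifford B) :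
    eta B (contr B B x u) = Exterior.contr B x (eta B u) := by
  rw [← sum_proj 𝒱 x]
  simp only [map_sum, LinearMap.sum_apply]
  exact Finset.sum_congr rfl fun i _ =>
    changeForm_contr (B := B) (B' := 0) (D := B) (by simp) B (proj_mem 𝒱 i x) u

theorem eta_signAut (i : ZMod 2) (u : Clifford B) :
    eta B (signAut B i u) = signAut 0 i (eta B u) :=
  changeForm_signAut (B := B) (B' := 0) (D := B) (by simp) i u

theorem eta_symm_of_mul_of (x y : V) :
    (eta B).symm (Exterior.of 𝒱 x * Exterior.of 𝒱 y) =
      of B x * of B y - algebraMap ℂ _ (B.form x y) := by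
  rw [LinearEquiv.symm_apply_eq, map_sub, eta_of_mul_of, eta_algebraMap,
    Algebra.algebraMap_eq_smul_one, add_sub_cancel_right]

variable {B} {κ : Type*} [Fintype κ]

theorem of_injective (F : DualFamily B κ) : Function.Injective (of B) := fun x y h =>
  Exterior.of_injective F (by rw [← eta_of B, ← eta_of B, h])

/-- An element of the Clifford algebra killed by the contractions with homogeneous vectors is a
scalar. -/
theorem exists_eq_algebraMap (F : DualFamily B κ) (u : Clifford B)
    (hu : ∀ i, ∀ x ∈ 𝒱 i, contr B B x u = 0) : ∃ c : ℂ, u = algebraMap ℂ _ c := by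
  obtain ⟨c, hc⟩ := Exterior.exists_eq_algebraMap F (eta B u) fun x => by
    rw [← eta_contr, ← sum_proj 𝒱 x]
    simp only [map_sum, LinearMap.sum_apply]
    exact Finset.sum_eq_zero fun i _ => by rw [hu i _ (proj_mem 𝒱 i x), map_zero]
  exact ⟨c, (eta B).injective (by rw [hc, eta_algebraMap])⟩

/-! ### The adjoint elements of an odd element -/

/-- The element `2 ι(x) f`, which acts on `V` by the bracket of the cubic element `f`. -/
def adElem (f : Clifford B) : V →ₗ[ℂ] Clifford B := (2 : ℂ) • (contr B B).flip f

theorem adElem_apply (f : Clifford B) (x : V) : adElem f x = (2 : ℂ) • contr B B x f := rfl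

variable {f : Clifford B}

theorem adElem_eq (hf : ∀ i, signAut B i f = -f) (x : V) :
    adElem f x = of B x * f + f * of B x := by
  have h : adElem f = LinearMap.mulRight ℂ f ∘ₗ of B + LinearMap.mulLeft ℂ f ∘ₗ of B := by
    refine hom_ext 𝒱 fun i x hx => ?_
    have e := of_mul_eq B hx f
    rw [hf] at e
    simp only [adElem_apply, LinearMap.add_apply, LinearMap.comp_apply, LinearMap.mulRight_apply,
      LinearMap.mulLeft_apply]
    rw [e, neg_mul, neg_add_cancel_right]
  rw [h]; rfl

theorem signAut_adElem (hf : ∀ i, signAut B i f = -f) (i : ZMod 2) {j : ZMod 2} {x : V}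
    (hx : x ∈ 𝒱 j) : signAut B i (adElem f x) = sgn i j • adElem f x := by
  simp only [adElem_eq hf, map_add, map_mul, hf, signAut_of B i hx, neg_mul_neg, smul_mul_assoc,
    mul_smul_comm, smul_add]

/-- The supercommutator of two adjoint elements minus the adjoint element of the bracket. -/
def adDefect (f : Clifford B) (br : V →ₗ[ℂ] V →ₗ[ℂ] V) (i j : ZMod 2) (x y : V) : Clifford B :=
  adElem f x * adElem f y - sgn i j • (adElem f y * adElem f x) - (2 : ℂ) • adElem f (br x y)

theorem bracket_skew (F : DualFamily B κ) {br : V →ₗ[ℂ] V →ₗ[ℂ] V}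
    (hbr : ∀ x y, of B (br x y) = (2 : ℂ) • contr B B x (contr B B y f)) (i j : ZMod 2) (x : V)
    (hx : x ∈ 𝒱 i) (y : V) (hy : y ∈ 𝒱 j) : br x y = -(sgn j i • br y x) := by
  refine of_injective F ?_
  rw [map_neg, map_smul, hbr, hbr, sgn_comm j i]
  linear_combination (norm := module) (2 : ℂ) • contr_contr_pair B B B hx hy f

theorem adElem_mul_of (F : DualFamily B κ) (hf : ∀ i, signAut B i f = -f)
    {br : V →ₗ[ℂ] V →ₗ[ℂ] V}
    (hbr : ∀ x y, of B (br x y) = (2 : ℂ) • contr B B x (contr B B y f)) {i j : ZMod 2} {x y : V}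
    (hx : x ∈ 𝒱 i) (hy : y ∈ 𝒱 j) :
    adElem f x * of B y = sgn i j • (of B y * adElem f x) + (2 : ℂ) • of B (br x y) := by
  have e := of_mul_eq B hy (adElem f x)
  rw [signAut_adElem hf j hx, adElem_apply f x, map_smul, ← hbr, ← adElem_apply] at e
  rw [smul_mul_assoc, sgn_comm j i] at e
  have hs := congrArg (· • (adElem f x * of B y)) (sgn_mul_self i j)
  rw [bracket_skew F hbr i j x hx y hy, map_neg, map_smul, sgn_comm j i]
  linear_combination (norm := module) -sgn i j • e - hs

theorem adDefect_eq (F : DualFamily B κ) (hf : ∀ i, signAut B i f = -f)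
    {br : V →ₗ[ℂ] V →ₗ[ℂ] V}
    (hbr : ∀ x y, of B (br x y) = (2 : ℂ) • contr B B x (contr B B y f)) {i j : ZMod 2} {x y : V}
    (hx : x ∈ 𝒱 i) (hy : y ∈ 𝒱 j) :
    adDefect f br i j x y = (adElem f x * f - f * adElem f x) * of B y +
      sgn i j • (of B y * (adElem f x * f - f * adElem f x)) := by
  have e := adElem_mul_of F hf hbr hx hy
  have e1 := congrArg (· * f) e
  have e2 := congrArg (f * ·) e
  rw [adDefect, adElem_eq hf y, adElem_eq hf (br x y)]
  simp only [add_mul, mul_add, sub_mul, mul_sub, smul_mul_assoc, mul_smul_comm, mul_assoc] at *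
  linear_combination (norm := module) e1 + e2

theorem adDefect_mul_of (F : DualFamily B κ) (hf : ∀ i, signAut B i f = -f)
    {br : V →ₗ[ℂ] V →ₗ[ℂ] V}
    (hbr : ∀ x y, of B (br x y) = (2 : ℂ) • contr B B x (contr B B y f))
    (hmem : ∀ i j : ZMod 2, ∀ x ∈ 𝒱 i, ∀ y ∈ 𝒱 j, br x y ∈ 𝒱 (i + j)) {i j k : ZMod 2} {x y z : V}
    (hx : x ∈ 𝒱 i) (hy : y ∈ 𝒱 j) (hz : z ∈ 𝒱 k) :
    adDefect f br i j x y * of B z - (sgn i k * sgn j k) • (of B z * adDefect f br i j x y) =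
      (4 : ℂ) • of B (br x (br y z) - br (br x y) z - sgn i j • br y (br x z)) := by
  have a := adElem_mul_of F hf hbr hx hz
  have b := adElem_mul_of F hf hbr hy hz
  have c := adElem_mul_of F hf hbr hx (hmem j k y hy z hz)
  have d := adElem_mul_of F hf hbr hy (hmem i k x hx z hz)
  have e := adElem_mul_of F hf hbr (hmem i j x hx y hy) hz
  have a1 := congrArg (· * adElem f y) a
  have a2 := congrArg (adElem f y * ·) a
  have b1 := congrArg (· * adElem f x) b
  have b2 := congrArg (adElem f x * ·) b
  have s := congrArg (fun t => (2 * sgn j k * t) • (of B (br x z) * adElem f y)) (sgn_mul_self i j)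
  rw [sgn_comm (i + j) k, sgn_add_right, sgn_comm k i, sgn_comm k j] at e
  rw [sgn_add_right] at c d
  rw [sgn_comm j i] at d
  simp only [adDefect, map_sub, map_smul]
  simp only [add_mul, mul_add, sub_mul, mul_sub, smul_mul_assoc, mul_smul_comm, mul_assoc] at *
  linear_combination (norm := module) b2 + sgn j k • a1 + (2 : ℂ) • c - sgn i j • a2 -
    (sgn i j * sgn i k) • b1 - (2 * sgn i j) • d - (2 : ℂ) • e - s

theorem adElem_commutator (hf : ∀ i, signAut B i f = -f) (x : V) :
    adElem f x * f - f * adElem f x = of B x * (f * f) - f * f * of B x := by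
  rw [adElem_eq hf]; noncomm_ring

/-- The Jacobi identity for the bracket of an element with scalar square. -/
theorem jacobi_of_sq_eq_algebraMap (F : DualFamily B κ) (hf : ∀ i, signAut B i f = -f)
    {br : V →ₗ[ℂ] V →ₗ[ℂ] V}
    (hbr : ∀ x y, of B (br x y) = (2 : ℂ) • contr B B x (contr B B y f))
    (hmem : ∀ i j : ZMod 2, ∀ x ∈ 𝒱 i, ∀ y ∈ 𝒱 j, br x y ∈ 𝒱 (i + j)) {c : ℂ}
    (hc : f * f = algebraMap ℂ _ c) (i j k : ZMod 2) (x : V) (hx : x ∈ 𝒱 i) (y : V) (hy : y ∈ 𝒱 j)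
    (z : V) (hz : z ∈ 𝒱 k) :
    br x (br y z) = br (br x y) z + sgn j i • br y (br x z) := by
  have hW : adElem f x * f - f * adElem f x = 0 := by
    rw [adElem_commutator hf, hc, Algebra.commutes, sub_self]
  have h := adDefect_mul_of F hf hbr hmem hx hy hz
  rw [adDefect_eq F hf hbr hx hy, hW] at h
  simp only [zero_mul, mul_zero, smul_zero, add_zero, sub_zero] at h
  have h0 := (smul_eq_zero.mp h.symm).resolve_left (by norm_num)
  have h1 := of_injective F (h0.trans (map_zero _).symm)
  rw [sgn_comm j i]
  linear_combination (norm := module) h1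

/-- The scalar part of an element of the Clifford algebra. -/
def scalarPart (B : SuperForm 𝒱) : Clifford B →ₗ[ℂ] ℂ :=
  (Exterior.counit 𝒱).toLinearMap ∘ₗ (eta B).toLinearMap

theorem scalarPart_apply (u : Clifford B) : scalarPart B u = Exterior.counit 𝒱 (eta B u) := rfl

theorem scalarPart_algebraMap (c : ℂ) : scalarPart B (algebraMap ℂ _ c) = c := by
  rw [scalarPart_apply, eta_algebraMap, AlgHom.commutes]; rfl

theorem scalarPart_of_mul_of (x y : V) : scalarPart B (of B x * of B y) = B.form x y := by
  rw [scalarPart_apply, eta_of_mul_of, map_add, Exterior.counit_of_mul]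
  simp

theorem eta_adElem (f : Clifford B) (x : V) :
    eta B (adElem f x) = (2 : ℂ) • Exterior.contr B x (eta B f) := by
  rw [adElem_apply, map_smul, eta_contr]

theorem scalarPart_adElem (hφ : eta B f ∈ Exterior.component 𝒱 3 0) (x : V) :
    scalarPart B (adElem f x) = 0 := by
  rw [scalarPart_apply, eta_adElem, map_smul,
    Exterior.counit_quadratic (Exterior.contr_cubic_mem B hφ x), smul_zero]

/-- For an invariant bracket, supercommutators of adjoint elements with quadratic elements have no
scalar part. -/
theorem scalarPart_commutator (F : DualFamily B κ) (hf : ∀ i, signAut B i f = -f)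
    {br : V →ₗ[ℂ] V →ₗ[ℂ] V}
    (hbr : ∀ x y, of B (br x y) = (2 : ℂ) • contr B B x (contr B B y f))
    (hinv : ∀ x y z, B.form (br x y) z = B.form x (br y z)) {i : ZMod 2} {x : V} (hx : x ∈ 𝒱 i)
    {u : Exterior 𝒱} (hu : u ∈ Exterior.quadratic 𝒱) :
    scalarPart B (adElem f x * (eta B).symm u -
      signAut B i ((eta B).symm u) * adElem f x) = 0 := by
  induction hu using Submodule.span_induction with
  | mem u hu =>
    obtain ⟨j, k, a, b, ha, hb, rfl⟩ := hu
    have e1 := congrArg (· * of B b) (adElem_mul_of F hf hbr hx ha)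
    have e2 := congrArg (of B a * ·) (adElem_mul_of F hf hbr hx hb)
    have hs : B.form (br x a) b = -(sgn i j * B.form a (br x b)) := by
      rw [bracket_skew F hbr i j x hx a ha, map_neg, map_smul, LinearMap.neg_apply,
        LinearMap.smul_apply, smul_eq_mul, hinv, sgn_comm]
    have h : adElem f x * (of B a * of B b - algebraMap ℂ _ (B.form a b)) -
        signAut B i (of B a * of B b - algebraMap ℂ _ (B.form a b)) * adElem f x =
        (2 : ℂ) • (of B (br x a) * of B b) + (2 * sgn i j) • (of B a * of B (br x b)) := by
      simp only [map_sub, map_mul, signAut_of B i ha, signAut_of B i hb, map_smul, map_one,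
        Algebra.algebraMap_eq_smul_one, add_mul, mul_add, sub_mul, mul_sub, smul_mul_assoc,
        mul_smul_comm, mul_assoc, neg_mul, mul_neg, one_mul, mul_one] at *
      linear_combination (norm := module) e1 + sgn i j • e2
    rw [eta_symm_of_mul_of, h, map_add, map_smul, map_smul, scalarPart_of_mul_of,
      scalarPart_of_mul_of, hs]
    simp only [smul_eq_mul]
    ring
  | zero => simp
  | add u v _ _ hu hv =>
    simp only [map_add, mul_add, add_mul]
    rw [add_sub_add_comm, map_add, hu, hv, add_zero]
  | smul c u _ hu =>
    simp only [map_smul, mul_smul_comm, smul_mul_assoc]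
    rw [← smul_sub, map_smul, hu, smul_zero]

/-- The square of a cubic element is a scalar if its bracket is invariant and satisfies the Jacobi
identity. -/
theorem sq_eq_algebraMap_of_jacobi (F : DualFamily B κ) (hφ : eta B f ∈ Exterior.component 𝒱 3 0)
    (hf : ∀ i, signAut B i f = -f) {br : V →ₗ[ℂ] V →ₗ[ℂ] V}
    (hbr : ∀ x y, of B (br x y) = (2 : ℂ) • contr B B x (contr B B y f))
    (hmem : ∀ i j : ZMod 2, ∀ x ∈ 𝒱 i, ∀ y ∈ 𝒱 j, br x y ∈ 𝒱 (i + j))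
    (hinv : ∀ x y z, B.form (br x y) z = B.form x (br y z))
    (hjac : ∀ i j k : ZMod 2, ∀ x ∈ 𝒱 i, ∀ y ∈ 𝒱 j, ∀ z ∈ 𝒱 k,
      br x (br y z) = br (br x y) z + sgn j i • br y (br x z)) :
    ∃ c : ℂ, f * f = algebraMap ℂ _ c := by
  have hR : ∀ i j : ZMod 2, ∀ x ∈ 𝒱 i, ∀ y ∈ 𝒱 j, adDefect f br i j x y = 0 := by
    intro i j x hx y hy
    obtain ⟨c, hc⟩ := exists_eq_algebraMap F (adDefect f br i j x y) fun k z hz => by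
      have h1 := adDefect_mul_of F hf hbr hmem hx hy hz
      rw [hjac i j k x hx y hy z hz, sgn_comm j i, add_sub_cancel_left, sub_self, map_zero,
        smul_zero] at h1
      have h2 := of_mul_eq B hz (adDefect f br i j x y)
      have h3 : signAut B k (adDefect f br i j x y) =
          (sgn i k * sgn j k) • adDefect f br i j x y := by
        simp only [adDefect, map_sub, map_smul, map_mul, signAut_adElem hf k hx,
          signAut_adElem hf k hy, signAut_adElem hf k (hmem i j x hx y hy), sgn_add_right,
          smul_mul_smul_comm, sgn_comm k i, sgn_comm k j]
        module
      have hs : sgn i k * sgn j k * (sgn i k * sgn j k) = 1 := by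
        rw [mul_mul_mul_comm, sgn_mul_self, sgn_mul_self, one_mul]
      rw [h3, smul_mul_assoc] at h2
      have h4 := congrArg (fun t => t • (of B z * adDefect f br i j x y)) hs
      have h5 : (2 : ℂ) • contr B B z (adDefect f br i j x y) = 0 := by
        linear_combination (norm := module) -h2 - (sgn i k * sgn j k) • h1 - h4
      exact (smul_eq_zero.mp h5).resolve_left two_ne_zero
    have h0 : scalarPart B (adDefect f br i j x y) = 0 := by
      have h := scalarPart_commutator F hf hbr hinv hx
        (Submodule.smul_mem _ (2 : ℂ) (Exterior.contr_cubic_mem B hφ y))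
      rw [← eta_adElem, LinearEquiv.symm_apply_apply, signAut_adElem hf i hy, smul_mul_assoc] at h
      rw [adDefect, map_sub, h, map_smul, scalarPart_adElem hφ, smul_zero, sub_zero]
    rw [hc, scalarPart_algebraMap] at h0
    rw [hc, h0, map_zero]
  have hW : ∀ i : ZMod 2, ∀ x ∈ 𝒱 i, adElem f x * f - f * adElem f x = 0 := by
    intro i x hx
    have hσ : ∀ j, signAut B j (adElem f x * f - f * adElem f x) =
        -(sgn i j • (adElem f x * f - f * adElem f x)) := fun j => by
      simp only [map_sub, map_mul, hf, signAut_adElem hf j hx, sgn_comm j i, mul_neg, neg_mul,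
        smul_mul_assoc, mul_smul_comm]
      module
    obtain ⟨c, hc⟩ := exists_eq_algebraMap F (adElem f x * f - f * adElem f x) fun j y hy => by
      have h1 := adDefect_eq F hf hbr hx hy
      rw [hR i j x hx y hy] at h1
      have h2 := of_mul_eq B hy (adElem f x * f - f * adElem f x)
      rw [hσ, neg_mul, smul_mul_assoc] at h2
      have h3 := congrArg (fun t => t • (of B y * (adElem f x * f - f * adElem f x)))
        (sgn_mul_self i j)
      have h4 : (2 : ℂ) • contr B B y (adElem f x * f - f * adElem f x) = 0 := by
        linear_combination (norm := module) -h2 - sgn i j • h1 - h3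
      exact (smul_eq_zero.mp h4).resolve_left two_ne_zero
    have h := hσ 0
    rw [hc, AlgHom.commutes, sgn_zero_right, one_smul] at h
    rw [hc]
    have h2 : (2 : ℂ) • algebraMap ℂ (Clifford B) c = 0 := by
      linear_combination (norm := module) h
    exact (smul_eq_zero.mp h2).resolve_left two_ne_zero
  refine exists_eq_algebraMap F _ fun i x hx => ?_
  have h1 := adElem_commutator hf x
  rw [hW i x hx] at h1
  have h2 := of_mul_eq B hx (f * f)
  rw [map_mul (signAut B i), hf, neg_mul_neg] at h2
  have h3 : (2 : ℂ) • contr B B x (f * f) = 0 := by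
    linear_combination (norm := module) -h1 - h2
  exact (smul_eq_zero.mp h3).resolve_left two_ne_zero

end Clifford

end

end SuperLie

namespace SuperLie

section

variable {V : Type*} [AddCommGroup V] [Module ℂ V] {𝒱 : ZMod 2 → Submodule ℂ V}

theorem QuadraticLieSuperStructure.ext_bracket {B : SuperForm 𝒱}
    {L L' : QuadraticLieSuperStructure B} (h : L.bracket = L'.bracket) : L = L' := by
  obtain ⟨⟨b, _, _, _⟩, _⟩ := L
  obtain ⟨⟨b', _, _, _⟩, _⟩ := L'
  obtain rfl : b = b' := h
  rfl

variable [DirectSum.Decomposition 𝒱]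

theorem homogeneous_induction {P : V → Prop} (add : ∀ x y, P x → P y → P (x + y))
    (mem : ∀ i, ∀ x ∈ 𝒱 i, P x) (x : V) : P x := by
  rw [← sum_proj 𝒱 x, show (Finset.univ : Finset (ZMod 2)) = {0, 1} from rfl,
    Finset.sum_pair (by decide)]
  exact add _ _ (mem 0 _ (proj_mem 𝒱 0 x)) (mem 1 _ (proj_mem 𝒱 1 x))

theorem Clifford.signAut_of' (B : SuperForm 𝒱) (i : ZMod 2) (y : V) :
    signAut B i (of B y) = -of B (twist 𝒱 i y) := by
  simp [signAut]

namespace Exterior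

variable {B : SuperForm 𝒱} {κ : Type*} [Fintype κ]

/-! ### The bracket of a cubic element -/

/-- The bracket `2 ι(x) ι(y) φ`, projected to `V`. -/
def cubicBracket (F : DualFamily B κ) (φ : Exterior 𝒱) : V →ₗ[ℂ] V →ₗ[ℂ] V :=
  LinearMap.mk₂ ℂ (fun x y => (2 : ℂ) • toVector F (contr B x (contr B y φ)))
    (by simp)
    (fun c x y => by simp only [map_smul, LinearMap.smul_apply]; rw [smul_comm]) (by simp)
    (fun c x y => by simp only [map_smul, LinearMap.smul_apply]; rw [smul_comm])

theorem of_cubicBracket (F : DualFamily B κ) {φ : Exterior 𝒱} (hφ : φ ∈ component 𝒱 3 0)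
    (x y : V) : of 𝒱 (cubicBracket F φ x y) = (2 : ℂ) • contr B x (contr B y φ) := by
  obtain ⟨v, hv⟩ := contr_quadratic_mem B (contr_cubic_mem B hφ y) x
  rw [cubicBracket, LinearMap.mk₂_apply, map_smul, ← hv, toVector_of]

theorem clifford_of_cubicBracket (F : DualFamily B κ) {φ : Exterior 𝒱} (hφ : φ ∈ component 𝒱 3 0)
    (x y : V) : Clifford.of B (cubicBracket F φ x y) =
      (2 : ℂ) • Clifford.contr B B x (Clifford.contr B B y ((eta B).symm φ)) := by
  refine (eta B).injective ?_
  rw [Clifford.eta_of, map_smul, Clifford.eta_contr, Clifford.eta_contr,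
    LinearEquiv.apply_symm_apply, of_cubicBracket F hφ]

theorem signAut_eta_symm (B : SuperForm 𝒱) {φ : Exterior 𝒱} (hφ : φ ∈ component 𝒱 3 0)
    (i : ZMod 2) : Clifford.signAut B i ((eta B).symm φ) = -(eta B).symm φ := by
  refine (eta B).injective ?_
  rw [Clifford.eta_signAut, LinearEquiv.apply_symm_apply, signAut_cubic i hφ, map_neg,
    LinearEquiv.apply_symm_apply]

theorem cubicBracket_mem (F : DualFamily B κ) {φ : Exterior 𝒱} (hφ : φ ∈ component 𝒱 3 0)
    (i j : ZMod 2) (x : V) (hx : x ∈ 𝒱 i) (y : V) (hy : y ∈ 𝒱 j) :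
    cubicBracket F φ x y ∈ 𝒱 (i + j) := by
  refine mem_of_twist_one (of_injective F ?_)
  have h1 := congrArg (contr B x) (Clifford.contr_signAut 0 B 1 hy φ)
  rw [signAut_cubic 1 hφ, map_neg, map_neg, map_neg, map_smul] at h1
  have h2 : contr B x (Clifford.signAut 0 1 (contr B y φ)) =
      -(sgn 1 i • Clifford.signAut 0 1 (contr B x (contr B y φ))) :=
    Clifford.contr_signAut 0 B 1 hx (contr B y φ)
  have h3 := Clifford.signAut_of' (0 : SuperForm 𝒱) 1 (cubicBracket F φ x y)
  rw [of_cubicBracket F hφ, map_smul] at h3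
  change -(contr B x (contr B y φ)) = -(sgn 1 j • contr B x (Clifford.signAut 0 1 (contr B y φ)))
    at h1
  rw [h2] at h1
  rw [map_smul, of_cubicBracket F hφ, sgn_add_right]
  have hs := congrArg (fun t => (2 * t * (sgn 1 j * sgn 1 j)) •
    Clifford.signAut 0 1 (contr B x (contr B y φ))) (sgn_mul_self 1 i)
  have hs' := congrArg (fun t => (2 * t) •
    Clifford.signAut 0 1 (contr B x (contr B y φ))) (sgn_mul_self 1 j)
  linear_combination (norm := module) h3 + (2 * (sgn 1 i * sgn 1 j)) • h1 + hs + hs'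

theorem contr_of_eq (x v : V) : counit 𝒱 (contr B x (of 𝒱 v)) = B.form x v := by
  rw [contr_of, map_smul, map_one, smul_eq_mul, mul_one]

theorem cubicBracket_invariant (F : DualFamily B κ) {φ : Exterior 𝒱} (hφ : φ ∈ component 𝒱 3 0)
    (x y z : V) :
    B.form (cubicBracket F φ x y) z = B.form x (cubicBracket F φ y z) := by
  induction x using homogeneous_induction (𝒱 := 𝒱) with
  | add x x' hx hx' => simp only [map_add, LinearMap.add_apply, hx, hx']
  | mem i x hx =>
  induction y using homogeneous_induction (𝒱 := 𝒱) with
  | add y y' hy hy' => simp only [map_add, LinearMap.add_apply, hy, hy']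
  | mem j y hy =>
  induction z using homogeneous_induction (𝒱 := 𝒱) with
  | add z z' hz hz' => simp only [map_add, hz, hz']
  | mem k z hz =>
  have h1 := Clifford.contr_contr_pair 0 B B hz hx (contr B y φ)
  have h2 := congrArg (contr B x) (Clifford.contr_contr_pair 0 B B hz hy φ)
  change contr B z (contr B x (contr B y φ)) + sgn k i • contr B x (contr B z (contr B y φ)) = 0
    at h1
  change contr B x (contr B z (contr B y φ) + sgn k j • contr B y (contr B z φ)) = contr B x 0
    at h2
  rw [map_add, map_smul, map_zero] at h2
  have hs := congrArg (fun t => (2 * sgn k j * t) • contr B x (contr B z (contr B y φ)))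
    (sgn_mul_self k i)
  have hs' := congrArg (fun t => (2 * t) • contr B x (contr B y (contr B z φ)))
    (sgn_mul_self k j)
  have key : (sgn k i * sgn k j) • (2 : ℂ) • contr B z (contr B x (contr B y φ)) =
      (2 : ℂ) • contr B x (contr B y (contr B z φ)) := by
    linear_combination (norm := module)
      (2 * (sgn k i * sgn k j)) • h1 - (2 * sgn k j) • h2 - hs + hs'
  have h := congrArg (counit 𝒱) key
  rw [B.superSymm (i + j) k _ (cubicBracket_mem F hφ i j x hx y hy) z hz, ← contr_of_eq,
    ← contr_of_eq, of_cubicBracket F hφ, of_cubicBracket F hφ, map_smul, map_smul (contr B x), ← h,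
    sgn_comm _ k, sgn_add_right, map_smul (counit 𝒱) (sgn k i * sgn k j), smul_eq_mul]

theorem cliffordMul_self_eq_algebraMap_iff (B : SuperForm 𝒱) (φ : Exterior 𝒱) (c : ℂ) :
    cliffordMul B φ φ = algebraMap ℂ _ c ↔
      (eta B).symm φ * (eta B).symm φ = algebraMap ℂ _ c := by
  rw [cliffordMul, ← Clifford.eta_algebraMap B, (eta B).injective.eq_iff]

/-- The quadratic Lie superalgebra structure of a cubic element with scalar Clifford square. -/
def quadraticStructure (F : DualFamily B κ) (φ : scalarSquareCubics B) :
    QuadraticLieSuperStructure B where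
  bracket := cubicBracket F φ
  bracket_mem := cubicBracket_mem F φ.2.1
  skew := Clifford.bracket_skew F (clifford_of_cubicBracket F φ.2.1)
  jacobi := by
    obtain ⟨c, hc⟩ := φ.2.2
    exact Clifford.jacobi_of_sq_eq_algebraMap F (signAut_eta_symm B φ.2.1)
      (clifford_of_cubicBracket F φ.2.1) (cubicBracket_mem F φ.2.1)
      ((cliffordMul_self_eq_algebraMap_iff B _ c).mp hc)
  invariant := cubicBracket_invariant F φ.2.1

theorem quadraticStructure_injective (F : DualFamily B κ) :
    Function.Injective (quadraticStructure F) := by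
  rintro ⟨φ, hφ⟩ ⟨ψ, hψ⟩ h
  have hbr : cubicBracket F φ = cubicBracket F ψ :=
    congrArg (fun L : QuadraticLieSuperStructure B => L.bracket) h
  have hsub := sub_mem hφ.1 hψ.1
  refine Subtype.ext (sub_eq_zero.mp ?_)
  refine eq_zero_of_contr_eq_zero F _ (fun y => ?_) (counit_cubic hsub)
  refine eq_zero_of_contr_eq_zero F _ (fun x => ?_) (counit_quadratic (contr_cubic_mem B hsub y))
  have h1 := of_cubicBracket F hφ.1 x y
  rw [hbr, of_cubicBracket F hψ.1] at h1
  have h2 := smul_right_injective (Exterior 𝒱) (two_ne_zero (α := ℂ)) h1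
  rw [map_sub, map_sub, ← h2, sub_self]

/-! ### The cubic element of a bracket -/

/-- The quadratic elements `∑ e_l ∧ [e'_l, x]`. -/
def bracketQuadratic (F : DualFamily B κ) (L : QuadraticLieSuperStructure B) :
    V →ₗ[ℂ] Exterior 𝒱 :=
  ∑ l, LinearMap.mulLeft ℂ (of 𝒱 (F.e l)) ∘ₗ of 𝒱 ∘ₗ L.bracket (F.e' l)

theorem bracketQuadratic_apply (F : DualFamily B κ) (L : QuadraticLieSuperStructure B) (x : V) :
    bracketQuadratic F L x = ∑ l, of 𝒱 (F.e l) * of 𝒱 (L.bracket (F.e' l) x) := by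
  simp [bracketQuadratic]

theorem contr_bracketQuadratic (F : DualFamily B κ) (L : QuadraticLieSuperStructure B) {i : ZMod 2}
    {z : V} (hz : z ∈ 𝒱 i) (x : V) :
    contr B z (bracketQuadratic F L x) = (2 : ℂ) • of 𝒱 (L.bracket z x) := by
  have h1 : ∑ l, B.form z (F.e l) • of 𝒱 (L.bracket (F.e' l) x) = of 𝒱 (L.bracket z x) := by
    conv_rhs => rw [← F.sum_right z]
    simp
  have h2 : ∑ l, B.form (F.e' l) (L.bracket z x) • of 𝒱 (F.e l) = of 𝒱 (L.bracket z x) := by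
    conv_rhs => rw [← F.sum_left (L.bracket z x)]
    simp
  rw [bracketQuadratic_apply, map_sum, two_smul]
  conv_rhs => rw [← h1]; arg 2; rw [h1, ← h2]
  rw [← Finset.sum_add_distrib]
  refine Finset.sum_congr rfl fun l _ => ?_
  have hs : B.form z (L.bracket (F.e' l) x) =
      -(sgn i (F.par l) * B.form (F.e' l) (L.bracket z x)) := by
    rw [← L.invariant, L.skew i _ z hz _ (F.mem' l), map_neg, map_smul, LinearMap.neg_apply,
      LinearMap.smul_apply, L.invariant, smul_eq_mul, sgn_comm]
  have e := congrArg (fun t => (t * B.form (F.e' l) (L.bracket z x)) • of 𝒱 (F.e l))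
    (sgn_mul_self i (F.par l))
  rw [contr_of_mul B hz (F.mem l), contr_of, hs, mul_smul_comm, mul_one]
  linear_combination (norm := module) e

/-- The cubic element of a quadratic Lie superalgebra structure. -/
def bracketCubic (F : DualFamily B κ) (L : QuadraticLieSuperStructure B) : Exterior 𝒱 :=
  (1 / 12 : ℂ) • ∑ k, of 𝒱 (F.e k) * bracketQuadratic F L (F.e' k)

theorem bracketCubic_mem (F : DualFamily B κ) (L : QuadraticLieSuperStructure B) :
    bracketCubic F L ∈ component 𝒱 3 0 := by
  refine Submodule.smul_mem _ _ (Submodule.sum_mem _ fun k _ => ?_)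
  rw [bracketQuadratic_apply, Finset.mul_sum]
  refine Submodule.sum_mem _ fun l _ => mul_mul_mem_component_three ?_ (F.mem k) (F.mem l)
    (L.bracket_mem _ _ _ (F.mem' l) _ (F.mem' k))
  generalize F.par k = a
  generalize F.par l = b
  revert a b
  decide

theorem contr_bracketCubic (F : DualFamily B κ) (L : QuadraticLieSuperStructure B) (z : V) :
    contr B z (bracketCubic F L) = (1 / 4 : ℂ) • bracketQuadratic F L z := by
  induction z using homogeneous_induction (𝒱 := 𝒱) with
  | add x y hx hy => rw [map_add, LinearMap.add_apply, hx, hy, map_add, smul_add]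
  | mem i z hz =>
    have h1 : ∑ k, B.form z (F.e k) • bracketQuadratic F L (F.e' k) = bracketQuadratic F L z := by
      conv_rhs => rw [← F.sum_right z]
      simp
    have h2 : contr B z (∑ k, of 𝒱 (F.e k) * bracketQuadratic F L (F.e' k)) =
        ∑ k, B.form z (F.e k) • bracketQuadratic F L (F.e' k) +
          (2 : ℂ) • bracketQuadratic F L z := by
      rw [bracketQuadratic_apply F L z, Finset.smul_sum, ← Finset.sum_add_distrib, map_sum]
      refine Finset.sum_congr rfl fun k _ => ?_
      have e := congrArg (fun t => (2 * t) • (of 𝒱 (F.e k) * of 𝒱 (L.bracket (F.e' k) z)))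
        (sgn_mul_self i (F.par k))
      rw [contr_of_mul B hz (F.mem k), contr_bracketQuadratic F L hz,
        L.skew i _ z hz _ (F.mem' k), sgn_comm _ i, map_neg, map_smul, smul_neg, mul_neg,
        mul_smul_comm, mul_smul_comm]
      linear_combination (norm := module) e
    rw [bracketCubic, map_smul, h2, h1]
    module

theorem two_smul_contr_contr_bracketCubic (F : DualFamily B κ) (L : QuadraticLieSuperStructure B)
    (x y : V) :
    (2 : ℂ) • contr B x (contr B y (bracketCubic F L)) = of 𝒱 (L.bracket x y) := by
  rw [contr_bracketCubic, map_smul]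
  induction x using homogeneous_induction (𝒱 := 𝒱) with
  | add x x' hx hx' =>
    simp only [map_add, LinearMap.add_apply, smul_add] at *
    rw [hx, hx']
  | mem i x hx =>
    rw [contr_bracketQuadratic F L hx]
    module

theorem bracketCubic_mem_scalarSquareCubics (F : DualFamily B κ)
    (L : QuadraticLieSuperStructure B) : bracketCubic F L ∈ scalarSquareCubics B := by
  refine ⟨bracketCubic_mem F L, ?_⟩
  simp only [cliffordMul_self_eq_algebraMap_iff]
  refine Clifford.sq_eq_algebraMap_of_jacobi F (br := L.bracket) ?_
    (signAut_eta_symm B (bracketCubic_mem F L)) (fun x y => ?_) L.bracket_mem L.invariant L.jacobi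
  · rw [LinearEquiv.apply_symm_apply]
    exact bracketCubic_mem F L
  · refine (eta B).injective ?_
    rw [Clifford.eta_of, map_smul, Clifford.eta_contr, Clifford.eta_contr,
      LinearEquiv.apply_symm_apply, two_smul_contr_contr_bracketCubic]

theorem quadraticStructure_surjective (F : DualFamily B κ) :
    Function.Surjective (quadraticStructure F) := fun L => by
  refine ⟨⟨bracketCubic F L, bracketCubic_mem_scalarSquareCubics F L⟩,
    QuadraticLieSuperStructure.ext_bracket (LinearMap.ext₂ fun x y => of_injective F ?_)⟩
  exact (of_cubicBracket F (bracketCubic_mem F L) x y).trans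
    (two_smul_contr_contr_bracketCubic F L x y)

end Exterior

end

end SuperLie

end

theorem theorem3p2 {V : Type*} [AddCommGroup V] [Module ℂ V] [FiniteDimensional ℂ V]
    (𝒱 : ZMod 2 → Submodule ℂ V) [DirectSum.Decomposition 𝒱]
    (B : SuperLie.SuperForm 𝒱) (hB : B.form.Nondegenerate) :
    ∃ e : SuperLie.scalarSquareCubics B ≃ SuperLie.QuadraticLieSuperStructure B,
      ∀ (φ : SuperLie.scalarSquareCubics B) (z₁ z₂ : V),
        SuperLie.Exterior.of 𝒱 ((e φ).bracket z₁ z₂) =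
          (2 : ℂ) • SuperLie.Exterior.contr B z₁ (SuperLie.Exterior.contr B z₂ φ) := by
  obtain ⟨F⟩ := SuperLie.exists_dualFamily B hB
  exact ⟨Equiv.ofBijective (SuperLie.Exterior.quadraticStructure F)
    ⟨SuperLie.Exterior.quadraticStructure_injective F,
      SuperLie.Exterior.quadraticStructure_surjective F⟩,
    fun φ z₁ z₂ => SuperLie.Exterior.of_cubicBracket F φ.2.1 z₁ z₂⟩
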